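/- **Proposition 2 (Clean puncture realization).** Setting. Let $G=(V,E,F)$ be a finite cellulation of the sphere with a marked outer face $f_\infty\in F$ (for instance a cellulated closed disk, the planar patch, with its exterior added as the face $f_\infty$). Let $R_0,R_1\subseteq V$ be two disjoint, nonempty, connected sets of vertices (the rough holes). The rough boundary of $R_i$ is the set of vertices of $R_i$ that have an edge leaving $R_i$. A *bridge* is a simple path of edges (with at least one edge) from a vertex of the rough boundary of $R_0$ to a vertex of the rough boundary of $R_1$ whose non-terminal vertices all lie outside $R_0\cup R_1$. Let $\widehat G=G/(R_0,R_1)$ be the complex obtained by collapsing each hole $R_i$, that is, the subcomplex consisting of the vertices of $R_i$ and of all edges and faces all of whose vertices are in $R_i$, to one vertex $\hat r_i$; let $\widehat D$ and $\widehat B$ be its edge–vertex and face–edge incidence matrices over $\mathbb F_2$, let $A=\{\hat r_0,\hat r_1\}$, and write $\hat c$ for the image in $C_1(\widehat G;\mathbb F_2)$ of a $1$-chain $c$ of $G$. The punctured surface code has one qubit on each edge of $\widehat G$; its checks are the star checks $\prod_e X_e^{\widehat D_{v,e}}$ for $v\in V\setminus(R_0\cup R_1)$ and the plaquette checks $\prod_e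 Z_e^{\widehat B_{e,f}}$ for the faces $f\ne f_\infty$ of $\widehat G$. Let $\mathcal C$ be the simultaneous $+1$ eigenspace of all checks, $P_{\mathcal C}$ the orthogonal projector onto $\mathcal C$, and $Z(c)=\prod_{e\in c}Z_e$. Let $\{c_\alpha\}_{\alpha\in\mathcal I}$ be a family of bridges (the signal paths). Then: 1. $H_1(\widehat G,A;\mathbb F_2)\cong\mathbb F_2$. 2. For every bridge $c_\star$ and every $\alpha$, $[\hat c_\alpha]=[\hat c_\star]\neq 0$ in $H_1(\widehat G,A;\mathbb F_2)$; $\hat c_\alpha\oplus\hat c_\star$ is a sum of boundaries of plaquettes $f\neq f_\infty$ of $\widehat G$, and $Z(c_\alpha)$ is $Z(c_\star)$ times the product of the corresponding plaquette checks; and $$P_{\mathcal C}Z(c_\alpha)P_{\mathcal C}=P_{\mathcal C}Z(c_\star)P_{\mathcal C}\neq 0 .$$ Moreover $Z(c_\star)$ is a nontrivial logical operator: it maps $\mathcal C$ into $\mathcal C$, and $P_{\mathcal C}Z(c_\star)P_{\mathcal C}$ is not a scalar multiple of $P_{\mathcal C}$. So all $Z(c_\alpha)$ realize the same nontrivial logical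 $\bar Z$. 3. (Converse.) There is a simple closed loop $w$ on the dual lattice (a cyclic sequence of distinct faces, $f_\infty$ allowed, in which consecutive faces share a crossed edge, the crossed edges being distinct) that separates $R_0$ from $R_1$: $R_0$ and $R_1$ lie in two different components of the graph $(V,E)$ with the edges crossed by $w$ deleted. For every such $w$, every signal path crosses $w$ with odd parity, $\langle w,c_\alpha\rangle=\sum_e w_e (c_\alpha)_e=1 \pmod 2$ for all $\alpha$. -/

import Mathlib

noncomputable section

open scoped Classical

/-- A finite cellulation of the sphere, given as a combinatorial map with a marked outer face.
A dart is an edge with a direction; `rot` turns a dart counterclockwise around its source and `rev`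
reverses it.  Vertices, edges and faces are the orbits of `rot`, `rev` and `rot⁻¹ * rev`
(the latter walks along the boundary of the face to the left of a dart).
`connected` and Euler's formula `euler` say that the underlying surface is a sphere.
Every cellulated closed disk (a planar patch), with its exterior added as the face `outer`,
is of this kind. -/
structure SphereMap (D : Type*) [Finite D] where
  rot : Equiv.Perm D
  rev : Equiv.Perm D
  rev_rev : ∀ d, rev (rev d) = d
  rev_ne : ∀ d, rev d ≠ d
  connected : MulAction.IsPretransitive (Subgroup.closure {rot, rev}) D
  euler :
    (Nat.card (Quotient (Equiv.Perm.SameCycle.setoid rot)) : ℤ)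
      - Nat.card (Quotient (Equiv.Perm.SameCycle.setoid rev))
      + Nat.card (Quotient (Equiv.Perm.SameCycle.setoid (rot⁻¹ * rev))) = 2
  outer : Quotient (Equiv.Perm.SameCycle.setoid (rot⁻¹ * rev))

namespace SphereMap

variable {D : Type*} [Finite D] (M : SphereMap D)

def Vertex : Type _ := Quotient (Equiv.Perm.SameCycle.setoid M.rot)

def Edge : Type _ := Quotient (Equiv.Perm.SameCycle.setoid M.rev)

def Face : Type _ := Quotient (Equiv.Perm.SameCycle.setoid (M.rot⁻¹ * M.rev))

instance : Finite M.Vertex := inferInstanceAs (Finite (Quotient _))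
instance : Finite M.Edge := inferInstanceAs (Finite (Quotient _))
instance : Finite M.Face := inferInstanceAs (Finite (Quotient _))
instance : Fintype M.Vertex := Fintype.ofFinite _
instance : Fintype M.Edge := Fintype.ofFinite _
instance : Fintype M.Face := Fintype.ofFinite _

/-- Source vertex of a dart. -/
def src (d : D) : M.Vertex := Quotient.mk _ d

/-- Target vertex of a dart. -/
def tgt (d : D) : M.Vertex := M.src (M.rev d)

/-- The undirected edge of a dart. -/
def edge (d : D) : M.Edge := Quotient.mk _ d

/-- The face to the left of a dart. -/
def face (d : D) : M.Face := Quotient.mk _ d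

/-! ### Simple primal paths and simple closed dual loops -/

/-- A simple primal path: a walk with at least one edge and no repeated vertex. -/
structure SimplePath where
  length : ℕ
  length_pos : 0 < length
  vert : Fin (length + 1) → M.Vertex
  dart : Fin length → D
  src_dart : ∀ i, M.src (dart i) = vert i.castSucc
  tgt_dart : ∀ i, M.tgt (dart i) = vert i.succ
  simple : Function.Injective vert

/-- The `F₂`-valued `1`-chain supported on a simple path. -/
def SimplePath.chain {M : SphereMap D} (p : M.SimplePath) : M.Edge → ZMod 2 :=
  fun e => if ∃ i, M.edge (p.dart i) = e then 1 else 0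

/-- A simple closed dual loop: a cyclic sequence of pairwise distinct faces (the outer face is
allowed), each step going from the left face of `dart i` to the face on its right and so crossing
the primal edge of `dart i`; the crossed edges are pairwise distinct. -/
structure SimpleDualLoop where
  len : ℕ
  dart : Fin (len + 1) → D
  step : ∀ i, M.face (M.rev (dart i)) = M.face (dart (i + 1))
  simple : Function.Injective fun i => M.face (dart i)
  edge_inj : Function.Injective fun i => M.edge (dart i)

/-- The `F₂`-valued `1`-cochain that records which primal edges the loop crosses. -/
def SimpleDualLoop.cochain {M : SphereMap D} (w : M.SimpleDualLoop) : M.Edge → ZMod 2 :=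
  fun e => if ∃ i, M.edge (w.dart i) = e then 1 else 0

/-- The crossing parity `⟨w, c⟩ = ∑ₑ wₑ cₑ` modulo `2`. -/
def pairing (w c : M.Edge → ZMod 2) : ZMod 2 := ∑ e, w e * c e

/-- The set of vertices that can be reached from `a` along primal edges not crossed by `w`,
that is, the vertices on the side of `w` that contains `a`. -/
def side (w : M.Edge → ZMod 2) (a : M.Vertex) : Set M.Vertex :=
  {b | Relation.ReflTransGen
    (fun u v => ∃ d, M.src d = u ∧ M.tgt d = v ∧ w (M.edge d) = 0) a b}

/-- `w` separates `S` from `T`: these sets lie in two different sides of `w`. -/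
def Separates (w : M.Edge → ZMod 2) (S T : Set M.Vertex) : Prop :=
  ∃ a b, S ⊆ M.side w a ∧ T ⊆ M.side w b ∧ b ∉ M.side w a

/-! ### Rough holes and bridges -/

/-- A nonempty set of vertices that is connected along primal edges inside the set. -/
def IsConnectedRegion (S : Set M.Vertex) : Prop :=
  S.Nonempty ∧ ∀ u ∈ S, ∀ v ∈ S, Relation.ReflTransGen
    (fun x y => x ∈ S ∧ y ∈ S ∧ ∃ d, M.src d = x ∧ M.tgt d = y) u v

/-- Two rough holes, given by the vertices whose star checks are turned off: two disjoint
connected regions. -/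
structure IsHolePair (R : Fin 2 → Set M.Vertex) : Prop where
  conn : ∀ i, M.IsConnectedRegion (R i)
  disj : Disjoint (R 0) (R 1)

/-- The rough boundary of a hole: the vertices of the hole with an edge that leaves it. -/
def roughBoundary (S : Set M.Vertex) : Set M.Vertex :=
  {v | v ∈ S ∧ ∃ d, M.src d = v ∧ M.tgt d ∉ S}

/-- A simple path from the rough boundary of `R 0` to that of `R 1` all of whose non-terminal
vertices are active, i.e. lie in neither hole. -/
structure IsBridge (R : Fin 2 → Set M.Vertex) (p : M.SimplePath) : Prop where
  start_mem : p.vert 0 ∈ M.roughBoundary (R 0)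
  end_mem : p.vert (Fin.last p.length) ∈ M.roughBoundary (R 1)
  interior_active : ∀ j, j ≠ 0 → j ≠ Fin.last p.length → ∀ i, p.vert j ∉ R i

/-! ### The quotient complex `Ĝ = G / (R 0, R 1)`

Each hole is the subcomplex spanned by its vertices: it consists of these vertices and of all edges
and faces all of whose vertices are among them.  Each hole is collapsed to one vertex. -/

section Quotient

variable (R : Fin 2 → Set M.Vertex)

/-- Vertices of the quotient: active vertices `inl v` and the collapsed holes `inr i`. -/
abbrev HatVertex : Type _ := {v : M.Vertex // ∀ i, v ∉ R i} ⊕ Fin 2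

/-- Edges of the quotient: the edges that do not lie inside a hole. -/
abbrev HatEdge : Type _ := {e : M.Edge // ¬ ∃ i, ∀ d, M.edge d = e → M.src d ∈ R i}

/-- Faces of the quotient: the faces that do not lie inside a hole. -/
abbrev HatFace : Type _ := {f : M.Face // ¬ ∃ i, ∀ d, M.face d = f → M.src d ∈ R i}

/-- The quotient map on vertices (for disjoint `R 0`, `R 1`). -/
def hatVertex (v : M.Vertex) : M.HatVertex R :=
  if h : ∀ i, v ∉ R i then Sum.inl ⟨v, h⟩
  else if v ∈ R 0 then Sum.inr 0 else Sum.inr 1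

/-- The edge-vertex incidence matrix of the quotient: number of ends of `e` at `x`, modulo `2`. -/
def hatD : Matrix (M.HatVertex R) (M.HatEdge R) (ZMod 2) :=
  fun x e => (Nat.card {d : D // M.edge d = e.1 ∧ M.hatVertex R (M.src d) = x} : ZMod 2)

/-- The face-edge incidence matrix of the quotient: number of sides of `e` on `f`, modulo `2`. -/
def hatB : Matrix (M.HatEdge R) (M.HatFace R) (ZMod 2) :=
  fun e f => (Nat.card {d : D // M.edge d = e.1 ∧ M.face d = f.1} : ZMod 2)

/-- The chain map induced by the quotient map on `1`-chains: edges inside the holes are dropped. -/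
def hatChain (c : M.Edge → ZMod 2) : M.HatEdge R → ZMod 2 := fun e => c e.1

/-- `C₀(A)` for the set `A` of the two collapsed vertices. -/
def markedChains : Submodule (ZMod 2) (M.HatVertex R → ZMod 2) :=
  Submodule.span (ZMod 2) (Set.range fun i : Fin 2 => Pi.single (Sum.inr i) 1)

/-- Relative `1`-cycles of `(Ĝ, A)`: `1`-chains whose boundary is supported on `A`. -/
def relCycles : Submodule (ZMod 2) (M.HatEdge R → ZMod 2) :=
  (M.markedChains R).comap (M.hatD R).mulVecLin

/-- Relative `1`-boundaries of `(Ĝ, A)`; since `A` has no `1`-cells these are the sums of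
plaquette boundaries. -/
def relBoundaries : Submodule (ZMod 2) (M.HatEdge R → ZMod 2) :=
  LinearMap.range (M.hatB R).mulVecLin

/-- The relative homology group `H₁(Ĝ, A; F₂)`. -/
abbrev RelH1 : Type _ := M.relCycles R ⧸ (M.relBoundaries R).submoduleOf (M.relCycles R)

end Quotient

end SphereMap

/-! ### Pauli operators -/

/-- The state space `(ℂ²)^{⊗ Q}` of qubits labelled by `Q`, with its computational basis indexed by
bit strings. -/
abbrev QubitSpace (Q : Type*) [Fintype Q] : Type _ := EuclideanSpace ℂ (Q → ZMod 2)

/-- `Z(c)`, the product of the Pauli operators `Zₑ` over the `e` with `c e = 1`: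
the basis vector of the bit string `x` is multiplied by `-1` for each `e` with `c e = x e = 1`. -/
def pauliZ {Q : Type*} [Fintype Q] (c : Q → ZMod 2) : Module.End ℂ (QubitSpace Q) where
  toFun ψ := WithLp.toLp 2 fun x => (∏ e, (-1 : ℂ) ^ (c e * x e).val) * ψ x
  map_add' ψ χ := by ext x; simp [mul_add]
  map_smul' a ψ := by ext x; simp [mul_left_comm]

/-- `X(w)`, the product of the Pauli operators `Xₑ` over the `e` with `w e = 1`:
the bits at these `e` are flipped. -/
def pauliX {Q : Type*} [Fintype Q] (w : Q → ZMod 2) : Module.End ℂ (QubitSpace Q) where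
  toFun ψ := WithLp.toLp 2 fun x => ψ (x + w)
  map_add' ψ χ := by ext x; simp
  map_smul' a ψ := by ext x; simp

theorem pauliZ_add {Q : Type*} [Fintype Q] (c c' : Q → ZMod 2) :
    pauliZ (c + c') = pauliZ c * pauliZ c' := by
  ext ψ x
  simp only [pauliZ, LinearMap.coe_mk, AddHom.coe_mk, Module.End.mul_apply, ← mul_assoc,
    ← Finset.prod_mul_distrib, Pi.add_apply]
  congr 1
  refine Finset.prod_congr rfl fun e _ => ?_
  generalize c e = a
  generalize c' e = b
  generalize x e = y
  have h : ((a + b) * y).val % 2 = ((a * y).val + (b * y).val) % 2 := by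
    revert a b y; decide
  rw [← pow_add, neg_one_pow_eq_pow_mod_two, h, ← neg_one_pow_eq_pow_mod_two]

theorem pauliX_add {Q : Type*} [Fintype Q] (w w' : Q → ZMod 2) :
    pauliX (w + w') = pauliX w * pauliX w' := by
  ext ψ x
  simp [pauliX, add_assoc]

namespace SphereMap

/-! ### The punctured surface code

The data qubits sit on the edges outside the holes.  The active checks are the star checks at the
vertices outside the holes and the `Z`-type plaquette checks of the faces other than the outer face;
at the edge of a hole a plaquette check acts on those qubits of its boundary that are present. -/

variable {D : Type*} [Finite D] (M : SphereMap D) (R : Fin 2 → Set M.Vertex)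

/-- The physical plaquettes of the punctured code. -/
abbrev Plaquette : Type _ := {f : M.HatFace R // f.1 ≠ M.outer}

/-- The star check at an active vertex. -/
def starCheck (v : {v : M.Vertex // ∀ i, v ∉ R i}) :
    Module.End ℂ (QubitSpace (M.HatEdge R)) :=
  pauliX fun e => M.hatD R (Sum.inl v) e

/-- The plaquette check of a face. -/
def plaquetteCheck (f : M.HatFace R) : Module.End ℂ (QubitSpace (M.HatEdge R)) :=
  pauliZ fun e => M.hatB R e f

/-- The code space: the simultaneous `+1` eigenspace of all active checks. -/
def codeSpace : Submodule ℂ (QubitSpace (M.HatEdge R)) :=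
  (⨅ v, (M.starCheck R v).eigenspace 1) ⊓
    ⨅ f : M.Plaquette R, (M.plaquetteCheck R f.1).eigenspace 1

/-- The orthogonal projector `P_C` onto the code space. -/
def codeProj : Module.End ℂ (QubitSpace (M.HatEdge R)) :=
  ((M.codeSpace R).starProjection : QubitSpace (M.HatEdge R) →L[ℂ] QubitSpace (M.HatEdge R))

/-- The operator `Z(c)` of a simple path on the qubits of the punctured code. -/
def pathZ (p : M.SimplePath) : Module.End ℂ (QubitSpace (M.HatEdge R)) :=
  pauliZ (M.hatChain R p.chain)

end SphereMap

end

noncomputable section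

open scoped Classical
open Matrix

/-! ### Incidence matrices modulo `2` -/

section Incidence

variable {D α β : Type*}

/-! All the topology comes from one fact: on the sphere a closed `F₂`-cochain is a coboundary
(`IsClosedCochain.exists_cobd`). This is a dimension count. Connectedness of the graph and of its
dual bounds two kernels by dimension 1, transposition equates the ranks of the two face-edge
matrices, and Euler's formula closes the gap.

The fact passes to the quotient: a closed cochain there, extended by zero, is closed on the sphere,
and its potential is constant on each connected hole, so it descends. Dually, every 1-cycle of the
quotient is a sum of face boundaries. Hence a relative class is determined by its boundary
coefficient at the second hole, which gives `F₂`. A bridge has boundary `r̂₀ + r̂₁`, so its class is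
nonzero and two bridges differ by face boundaries. Since all face boundaries add up to zero, the
outer face can be avoided, and the remaining plaquettes act trivially on the code space.

For nontriviality, uniform superpositions over cosets of the span of the star checks are
eigenvectors of `Z(c)`. The trivial coset and the coset of the inactive star at `r̂₁` lie in the
code space and give the signs `1` and `-1`.

For loops, the cochain of a simple dual loop is closed and minimal among nonzero closed cochains
(`SimpleDualLoop.eq_cochain`). If the loop separates the holes, it therefore equals the coboundary
of the indicator of one side, and its pairing with a bridge telescopes to `1`. A separating loop is
extracted from the coboundary of a component of the complement of `R 0`. -/

/-- The number of `d` with labels `a d = x` and `b d = y`, modulo `2`. -/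
def incidence (a : D → α) (b : D → β) : Matrix α β (ZMod 2) :=
  fun x y => (Nat.card {d : D // a d = x ∧ b d = y} : ZMod 2)

theorem incidence_apply [Fintype D] (a : D → α) (b : D → β) (x : α) (y : β) :
    incidence a b x y = ∑ d, if a d = x ∧ b d = y then 1 else 0 := by
  simp [incidence, Nat.card_eq_fintype_card, Fintype.card_subtype]

theorem incidence_transpose (a : D → α) (b : D → β) : (incidence a b)ᵀ = incidence b a := by
  ext x y
  simp [incidence, and_comm]

theorem incidence_mulVec [Fintype D] [Fintype β] (a : D → α) (b : D → β) (g : β → ZMod 2) (x : α) :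
    (incidence a b *ᵥ g) x = ∑ d, if a d = x then g (b d) else 0 := by
  simp only [mulVec, dotProduct, incidence_apply, Finset.sum_mul]
  rw [Finset.sum_comm]
  refine Finset.sum_congr rfl fun d _ => ?_
  by_cases h : a d = x <;> simp [h]

end Incidence

/-! ### Darts, their orbits, and connectedness of the graph and its dual -/

namespace SphereMap

variable {D : Type*} [Finite D] (M : SphereMap D)

theorem edge_eq_edge {d d' : D} : M.edge d = M.edge d' ↔ d = d' ∨ d = M.rev d' := by
  have hrev : ∀ (n : ℤ) (x : D), (M.rev ^ n) x = x ∨ (M.rev ^ n) x = M.rev x := by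
    have hinv : M.rev⁻¹ = M.rev := by
      ext x
      rw [Equiv.Perm.inv_eq_iff_eq, M.rev_rev]
    intro n
    induction n with
    | zero => simp
    | succ n ih =>
      intro x
      rw [_root_.zpow_add_one, Equiv.Perm.mul_apply]
      rcases ih (M.rev x) with h | h <;> rw [h] <;> simp [M.rev_rev]
    | pred n ih =>
      intro x
      rw [_root_.zpow_sub_one, Equiv.Perm.mul_apply, hinv]
      rcases ih (M.rev x) with h | h <;> rw [h] <;> simp [M.rev_rev]
  constructor
  · intro h
    obtain ⟨n, hn⟩ := (Quotient.exact h : M.rev.SameCycle d d')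
    rcases hrev n d with h | h
    · exact Or.inl (h.symm.trans hn)
    · exact Or.inr (by rw [← hn, h, M.rev_rev])
  · rintro (rfl | rfl)
    · rfl
    · exact Quotient.sound (⟨1, by simp [M.rev_rev]⟩ : M.rev.SameCycle (M.rev d') d')

theorem edge_rev (d : D) : M.edge (M.rev d) = M.edge d :=
  (M.edge_eq_edge).2 (Or.inr rfl)

theorem edge_surjective : Function.Surjective M.edge := Quotient.mk_surjective

theorem src_surjective : Function.Surjective M.src := Quotient.mk_surjective

theorem face_surjective : Function.Surjective M.face := Quotient.mk_surjective

theorem src_rot (d : D) : M.src (M.rot d) = M.src d :=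
  Quotient.sound (⟨-1, by simp⟩ : M.rot.SameCycle (M.rot d) d)

theorem tgt_rev (d : D) : M.tgt (M.rev d) = M.src d := by
  rw [tgt, M.rev_rev]

theorem face_next (d : D) : M.face ((M.rot⁻¹ * M.rev) d) = M.face d :=
  Quotient.sound (⟨-1, by simp⟩ : (M.rot⁻¹ * M.rev).SameCycle ((M.rot⁻¹ * M.rev) d) d)

theorem src_next (d : D) : M.src ((M.rot⁻¹ * M.rev) d) = M.tgt d := by
  rw [tgt, ← M.src_rot ((M.rot⁻¹ * M.rev) d)]
  simp

theorem sum_edge_eq [Fintype D] (h : D → ZMod 2) (d : D) :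
    (∑ d', if M.edge d' = M.edge d then h d' else 0) = h d + h (M.rev d) := by
  rw [← Finset.sum_filter,
    show Finset.univ.filter (fun d' => M.edge d' = M.edge d) = {d, M.rev d} by
      ext d'; simp [M.edge_eq_edge]]
  exact Finset.sum_pair (M.rev_ne d).symm

/-- A function on darts that is invariant under both permutations is constant. -/
theorem const_of_invariant {X : Type*} (h : D → X) (hrot : ∀ d, h (M.rot d) = h d)
    (hrev : ∀ d, h (M.rev d) = h d) (d d' : D) : h d = h d' := by
  obtain ⟨⟨σ, hσ⟩, rfl⟩ := M.connected.exists_smul_eq d d'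
  change h d = h (σ d)
  induction hσ using Subgroup.closure_induction generalizing d with
  | mem x hx =>
    rcases hx with rfl | rfl
    · exact (hrot d).symm
    · exact (hrev d).symm
  | one => rfl
  | mul x y _ _ hx hy => rw [Equiv.Perm.mul_apply, ← hx, ← hy]
  | inv x _ hx =>
    rw [hx (x⁻¹ d)]
    simp

theorem vertex_const {X : Type*} (g : M.Vertex → X) (h : ∀ d, g (M.src d) = g (M.tgt d))
    (u v : M.Vertex) : g u = g v := by
  obtain ⟨d, rfl⟩ := M.src_surjective u
  obtain ⟨d', rfl⟩ := M.src_surjective v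
  exact M.const_of_invariant (fun d => g (M.src d)) (fun d => by rw [M.src_rot])
    (fun d => (h d).symm) d d'

theorem face_const {X : Type*} (g : M.Face → X) (h : ∀ d, g (M.face d) = g (M.face (M.rev d)))
    (u v : M.Face) : g u = g v := by
  obtain ⟨d, rfl⟩ := M.face_surjective u
  obtain ⟨d', rfl⟩ := M.face_surjective v
  refine M.const_of_invariant (fun d => g (M.face d)) (fun d => ?_) (fun d => (h d).symm) d d'
  -- The dart after `rev (rot d)` on its face is `d`, so rotating about a vertex crosses just the
  -- edge of `rot d`.
  have h1 := M.face_next (M.rev (M.rot d))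
  rw [Equiv.Perm.mul_apply, M.rev_rev, show M.rot⁻¹ (M.rot d) = d by simp] at h1
  change g (M.face (M.rot d)) = g (M.face d)
  rw [h1, ← h]

/-! ### Cochains -/

/-- The coboundary of a `0`-cochain. -/
def cobd (g : M.Vertex → ZMod 2) : M.Edge → ZMod 2 := incidence M.edge M.src *ᵥ g

/-- A `1`-cochain that sums to zero around every face. -/
def IsClosedCochain (u : M.Edge → ZMod 2) : Prop := incidence M.face M.edge *ᵥ u = 0

theorem isClosedCochain_iff [Fintype D] (u : M.Edge → ZMod 2) :
    M.IsClosedCochain u ↔ ∀ f, (∑ d, if M.face d = f then u (M.edge d) else 0) = 0 := by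
  simp only [IsClosedCochain, funext_iff, incidence_mulVec, Pi.zero_apply]

theorem cobd_edge (g : M.Vertex → ZMod 2) (d : D) :
    M.cobd g (M.edge d) = g (M.src d) + g (M.tgt d) := by
  let _ := Fintype.ofFinite D
  rw [cobd, incidence_mulVec]
  exact M.sum_edge_eq (fun d => g (M.src d)) d

theorem cobd_edge_eq_zero {g : M.Vertex → ZMod 2} {d : D} :
    M.cobd g (M.edge d) = 0 ↔ g (M.src d) = g (M.tgt d) := by
  rw [cobd_edge, CharTwo.add_eq_zero]

theorem cobd_eq_zero {g : M.Vertex → ZMod 2} (h : M.cobd g = 0) (u v : M.Vertex) : g u = g v :=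
  M.vertex_const g (fun _ => M.cobd_edge_eq_zero.1 (congrFun h _)) u v

/-- Along a face the target of each dart is the source of the next one, so the sum counts every
corner twice. -/
theorem isClosedCochain_cobd (g : M.Vertex → ZMod 2) : M.IsClosedCochain (M.cobd g) := by
  let _ := Fintype.ofFinite D
  rw [isClosedCochain_iff]
  intro f
  have h : ∀ d, (if M.face d = f then M.cobd g (M.edge d) else 0) =
      (if M.face d = f then g (M.src d) else 0) +
      (if M.face ((M.rot⁻¹ * M.rev) d) = f then g (M.src ((M.rot⁻¹ * M.rev) d)) else 0) := by
    intro d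
    rw [cobd_edge, M.face_next, M.src_next]
    split_ifs <;> simp
  rw [Finset.sum_congr rfl fun d _ => h d, Finset.sum_add_distrib,
    Equiv.sum_comp (M.rot⁻¹ * M.rev) (fun d => if M.face d = f then g (M.src d) else 0),
    CharTwo.add_self_eq_zero]

theorem finrank_ker_cobd_le_one :
    Module.finrank (ZMod 2) (LinearMap.ker (incidence M.edge M.src).mulVecLin) ≤ 1 := by
  refine finrank_le_one ⟨fun _ => 1, ?_⟩ fun g => ?_
  · rw [LinearMap.mem_ker]
    funext e
    obtain ⟨d, rfl⟩ := M.edge_surjective e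
    exact (M.cobd_edge (fun _ => 1) d).trans (CharTwo.add_self_eq_zero _)
  · refine ⟨g.1 (M.src (Quotient.out M.outer)), ?_⟩
    ext v
    simpa using M.cobd_eq_zero (LinearMap.mem_ker.1 g.2) _ v

theorem finrank_ker_faceBoundary_le_one :
    Module.finrank (ZMod 2) (LinearMap.ker (incidence M.edge M.face).mulVecLin) ≤ 1 := by
  let _ := Fintype.ofFinite D
  have key : ∀ (x : M.Face → ZMod 2) (d : D), (incidence M.edge M.face *ᵥ x) (M.edge d) =
      x (M.face d) + x (M.face (M.rev d)) := fun x d => by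
    rw [incidence_mulVec]
    exact M.sum_edge_eq (fun d => x (M.face d)) d
  refine finrank_le_one ⟨fun _ => 1, ?_⟩ fun x => ?_
  · rw [LinearMap.mem_ker]
    funext e
    obtain ⟨d, rfl⟩ := M.edge_surjective e
    exact (key (fun _ => 1) d).trans (CharTwo.add_self_eq_zero _)
  · refine ⟨x.1 M.outer, ?_⟩
    ext f
    have h := M.face_const x.1 (fun d => ?_) M.outer f
    · simpa using h
    · rw [← CharTwo.add_eq_zero, ← key]
      exact congrFun (LinearMap.mem_ker.1 x.2) _

/-- The first cohomology of the sphere vanishes. -/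
theorem IsClosedCochain.exists_cobd {u : M.Edge → ZMod 2} (hu : M.IsClosedCochain u) :
    ∃ g, M.cobd g = u := by
  have hle : LinearMap.range (incidence M.edge M.src).mulVecLin ≤
      LinearMap.ker (incidence M.face M.edge).mulVecLin := by
    rintro _ ⟨g, rfl⟩
    exact M.isClosedCochain_cobd g
  have h1 := (incidence M.edge M.src).mulVecLin.finrank_range_add_finrank_ker
  have h2 := (incidence M.face M.edge).mulVecLin.finrank_range_add_finrank_ker
  have h3 := (incidence M.edge M.face).mulVecLin.finrank_range_add_finrank_ker
  have h4 : Module.finrank (ZMod 2) (LinearMap.range (incidence M.face M.edge).mulVecLin) =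
      Module.finrank (ZMod 2) (LinearMap.range (incidence M.edge M.face).mulVecLin) := by
    have := rank_transpose (incidence M.edge M.face)
    rwa [incidence_transpose] at this
  have h5 := M.finrank_ker_cobd_le_one
  have h6 := M.finrank_ker_faceBoundary_le_one
  have h7 : (Nat.card M.Vertex : ℤ) - Nat.card M.Edge + Nat.card M.Face = 2 := M.euler
  rw [Module.finrank_fintype_fun_eq_card, ← Nat.card_eq_fintype_card] at h1 h2 h3
  -- The coboundaries have dimension at least `V - 1`, the closed cochains at most `E - F + 1`, and
  -- these agree by Euler's formula.
  have heq := Submodule.eq_of_le_of_finrank_le hle (by omega)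
  have hmem : u ∈ LinearMap.ker (incidence M.face M.edge).mulVecLin := hu
  rw [← heq] at hmem
  exact hmem

/-! ### Paths and loops -/

theorem SimplePath.edge_injective {M : SphereMap D} (p : M.SimplePath) :
    Function.Injective fun i => M.edge (p.dart i) := by
  intro i j h
  rcases M.edge_eq_edge.1 h with h | h
  · have := p.simple ((p.src_dart i).symm.trans ((congrArg M.src h).trans (p.src_dart j)))
    exact Fin.castSucc_injective _ this
  · have h1 := p.simple ((p.src_dart i).symm.trans ((congrArg M.src h).trans (p.tgt_dart j)))
    have h2 := p.simple ((p.tgt_dart i).symm.trans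
      ((congrArg M.tgt h).trans ((M.tgt_rev _).trans (p.src_dart j))))
    simp only [Fin.ext_iff, Fin.val_castSucc, Fin.val_succ] at h1 h2
    omega

theorem sum_indicator_image {α ι : Type*} [Fintype α] [Fintype ι] {s : ι → α}
    [DecidablePred fun e => ∃ i, s i = e] (hs : Function.Injective s) (u : α → ZMod 2) :
    (∑ e, u e * if ∃ i, s i = e then 1 else 0) = ∑ i, u (s i) := by
  simp only [mul_ite, mul_one, mul_zero]
  rw [← Finset.sum_filter, show Finset.univ.filter (fun e => ∃ i, s i = e) =
    Finset.univ.image s by ext; simp]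
  exact Finset.sum_image fun i _ j _ h => hs h

theorem pairing_cobd_chain (g : M.Vertex → ZMod 2) (p : M.SimplePath) :
    M.pairing (M.cobd g) p.chain = g (p.vert 0) + g (p.vert (Fin.last p.length)) := by
  have key : ∀ (n : ℕ) (f : Fin (n + 1) → ZMod 2),
      ∑ i : Fin n, (f i.castSucc + f i.succ) = f 0 + f (Fin.last n) := by
    intro n
    induction n with
    | zero => intro f; exact (CharTwo.add_self_eq_zero _).symm
    | succ n ih =>
      intro f
      rw [Fin.sum_univ_castSucc]
      have := ih fun i => f i.castSucc
      simp only [Fin.castSucc_zero, Fin.succ_castSucc, Fin.succ_last] at this ⊢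
      rw [this, add_assoc, ← add_assoc (f (Fin.last n).castSucc), CharTwo.add_self_eq_zero,
        zero_add]
  refine (sum_indicator_image p.edge_injective (M.cobd g)).trans ?_
  rw [← key _ fun i => g (p.vert i)]
  exact Finset.sum_congr rfl fun i _ => by rw [cobd_edge, p.src_dart, p.tgt_dart]

/-- The sum around a face of a `1`-cochain supported on the edges that a simple dual loop crosses. -/
theorem SimpleDualLoop.sum_face [Fintype D] {M : SphereMap D} (w : M.SimpleDualLoop)
    {u : M.Edge → ZMod 2} (hu : ∀ e, w.cochain e = 0 → u e = 0) (f : M.Face) :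
    (∑ d, if M.face d = f then u (M.edge d) else 0) =
      ∑ i, ((if M.face (w.dart i) = f then u (M.edge (w.dart i)) else 0) +
        if M.face (w.dart (i + 1)) = f then u (M.edge (w.dart i)) else 0) := by
  have hu' : (fun e => u e * if ∃ i, M.edge (w.dart i) = e then 1 else 0) = u := by
    funext e
    by_cases h : ∃ i, M.edge (w.dart i) = e
    · simp [h]
    · have : u e = 0 := hu e (by simp [cochain, h])
      simp [h, this]
  have h1 := sum_indicator_image w.edge_inj
    fun e => u e * incidence M.face M.edge f e
  calc _ = (incidence M.face M.edge *ᵥ u) f := (incidence_mulVec _ _ _ _).symm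
    _ = ∑ e, (u e * incidence M.face M.edge f e) *
          if ∃ i, M.edge (w.dart i) = e then 1 else 0 := by
      refine Finset.sum_congr rfl fun e _ => ?_
      conv_lhs => rw [← hu']
      ring
    _ = _ := by
      rw [h1]
      refine Finset.sum_congr rfl fun i _ => ?_
      have h2 := M.sum_edge_eq (fun d => if M.face d = f then (1 : ZMod 2) else 0) (w.dart i)
      have h3 : incidence M.face M.edge f (M.edge (w.dart i)) =
          ∑ d, if M.edge d = M.edge (w.dart i) then (if M.face d = f then 1 else 0) else 0 := by
        refine (incidence_apply _ _ _ _).trans (Finset.sum_congr rfl fun d _ => ?_)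
        rw [← ite_and]
        exact if_congr and_comm rfl rfl
      simp only [h3, h2, w.step, mul_add, mul_ite, mul_one, mul_zero]

/-- Each face is left as often as it is entered; the cyclic shift of the index matches the two
counts. -/
theorem SimpleDualLoop.isClosedCochain {M : SphereMap D} (w : M.SimpleDualLoop) :
    M.IsClosedCochain w.cochain := by
  let _ := Fintype.ofFinite D
  rw [isClosedCochain_iff]
  intro f
  have h1 : ∀ i, w.cochain (M.edge (w.dart i)) = 1 := fun i => if_pos ⟨i, rfl⟩
  rw [w.sum_face (fun _ h => h), Finset.sum_add_distrib]
  simp only [h1]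
  have h2 := Equiv.sum_comp (Equiv.addRight (1 : Fin (w.len + 1)))
    (fun i => if M.face (w.dart i) = f then (1 : ZMod 2) else 0)
  simp only [Equiv.coe_addRight] at h2
  exact (congrArg (_ + ·) h2).trans (CharTwo.add_self_eq_zero _)

/-- The cochain of a simple dual loop is minimal among the nonzero closed cochains. -/
theorem SimpleDualLoop.eq_cochain {M : SphereMap D} (w : M.SimpleDualLoop) {u : M.Edge → ZMod 2}
    (hu : ∀ e, w.cochain e = 0 → u e = 0) (hc : M.IsClosedCochain u) (h0 : u ≠ 0) :
    u = w.cochain := by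
  let _ := Fintype.ofFinite D
  -- The loop visits the face of `dart (i + 1)` once, so closedness there involves only the edge of
  -- entry and the edge of exit.
  have hstep : ∀ i, u (M.edge (w.dart (i + 1))) = u (M.edge (w.dart i)) := by
    intro k
    have h := (M.isClosedCochain_iff u).1 hc (M.face (w.dart (k + 1)))
    have hface : ∀ i j, M.face (w.dart i) = M.face (w.dart j) ↔ i = j :=
      fun i j => w.simple.eq_iff
    rw [w.sum_face hu, Finset.sum_add_distrib] at h
    simp only [hface, add_left_inj, Finset.sum_ite_eq', Finset.mem_univ, if_true] at h
    exact CharTwo.add_eq_zero.1 h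
  have hconst : ∀ i, u (M.edge (w.dart i)) = u (M.edge (w.dart 0)) := by
    intro i
    induction i using Fin.induction with
    | zero => rfl
    | succ i ih => rw [← ih, ← hstep i.castSucc, Fin.coeSucc_eq_succ]
  have hne : u (M.edge (w.dart 0)) ≠ 0 := by
    intro hz
    refine h0 (funext fun e => ?_)
    by_cases h : ∃ i, M.edge (w.dart i) = e
    · obtain ⟨i, rfl⟩ := h
      rw [hconst, hz]; rfl
    · exact hu e (if_neg h)
  funext e
  by_cases h : ∃ i, M.edge (w.dart i) = e
  · obtain ⟨i, rfl⟩ := h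
    rw [hconst]
    exact (Fin.eq_one_of_ne_zero _ hne).trans (if_pos ⟨i, rfl⟩).symm
  · rw [hu e (if_neg h)]
    exact (if_neg h).symm

end SphereMap

/-! ### Extraction of simple dual loops, and separation of the holes -/

namespace SphereMap

variable {D : Type*} [Finite D] (M : SphereMap D)

/-- Otherwise `rev d` would be the only dart of its face in the support of `u`, and the sum around
that face would be nonzero. -/
theorem IsClosedCochain.exists_next {M : SphereMap D} {u : M.Edge → ZMod 2}
    (hc : M.IsClosedCochain u) (d : {d // u (M.edge d) ≠ 0}) :
    ∃ d' : {d // u (M.edge d) ≠ 0}, M.face d' = M.face (M.rev d) ∧ d'.1 ≠ M.rev d := by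
  let _ := Fintype.ofFinite D
  by_contra! hno
  have h := (M.isClosedCochain_iff u).1 hc (M.face (M.rev d))
  rw [Finset.sum_eq_single (M.rev d)] at h
  · rw [if_pos rfl, M.edge_rev] at h
    exact d.2 h
  · intro d' _ hd'
    split_ifs with hf
    · by_contra hu
      exact hd' (hno ⟨d', hu⟩ hf)
    · rfl
  · simp

/-- A nonzero closed cochain crosses all edges of some simple dual loop. -/
theorem IsClosedCochain.exists_simpleDualLoop {M : SphereMap D} {u : M.Edge → ZMod 2}
    (hc : M.IsClosedCochain u) (h0 : u ≠ 0) :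
    ∃ w : M.SimpleDualLoop, ∀ e, u e = 0 → w.cochain e = 0 := by
  choose n hface hne using hc.exists_next
  obtain ⟨e, he⟩ := Function.ne_iff.1 h0
  obtain ⟨d, rfl⟩ := M.edge_surjective e
  let s : ℕ → {d // u (M.edge d) ≠ 0} := fun k => n^[k] ⟨d, he⟩
  have hs : ∀ k, s (k + 1) = n (s k) := fun k => Function.iterate_succ_apply' n k _
  have hstep : ∀ k, M.face (M.rev (s k)) = M.face (s (k + 1)) := fun k => by rw [hs, hface]
  -- A walk that never turns straight back must revisit a face; stopping at the first return leaves
  -- distinct faces between the two visits.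
  have hex : ∃ j, ∃ i < j, M.face (s i) = M.face (s j) := by
    obtain ⟨i, j, hij, h⟩ := Finite.exists_ne_map_eq_of_infinite fun k => M.face (s k)
    rcases lt_or_gt_of_ne hij with hlt | hlt
    · exact ⟨j, i, hlt, h⟩
    · exact ⟨i, j, hlt, h.symm⟩
  obtain ⟨i, hij, hclose⟩ := Nat.find_spec hex
  have hmin : ∀ b < Nat.find hex, ∀ a < b, M.face (s a) ≠ M.face (s b) :=
    fun b hb a hab h => Nat.find_min hex hb ⟨a, hab, h⟩
  generalize Nat.find hex = j at *
  have hinj : ∀ a < j, ∀ b < j, M.face (s a) = M.face (s b) → a = b := by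
    intro a ha b hb h
    rcases lt_trichotomy a b with hab | hab | hab
    · exact absurd h (hmin b hb a hab)
    · exact hab
    · exact absurd h.symm (hmin a ha b hab)
  -- Distinctness of faces makes opposite darts consecutive in the cycle, and the walk never turns
  -- back. The closing step `b + 1 = j` is handled by exchanging the roles of `a` and `b`.
  have hback : ∀ a < j, ∀ b < j, i ≤ b → (s a).1 ≠ M.rev (s b) := by
    intro a ha b hb hib h
    have h1 : M.face (s a) = M.face (s (b + 1)) := by rw [h, hstep]
    by_cases hbj : b + 1 < j
    · have := hinj a ha _ hbj h1
      rw [this, hs] at h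
      exact hne _ h
    · have hb1 : b + 1 = j := by omega
      rw [hb1, ← hclose] at h1
      have hai := hinj a ha i hij h1
      have h2 : M.rev (s a) = (s b).1 := by rw [h, M.rev_rev]
      have h3 : M.face (s (a + 1)) = M.face (s b) := by rw [← hstep, h2]
      by_cases haj : a + 1 < j
      · have := hinj _ haj b hb h3
        rw [← this, hs] at h2
        exact hne _ h2.symm
      · have hab : a = b := by omega
        rw [hab] at h
        exact M.rev_ne _ h.symm
  -- The loop consists of the `j - i` darts from `s i` to `s (j - 1)`; `len` is one less than their
  -- number.
  refine ⟨⟨j - 1 - i, fun k => s (i + k), ?_, ?_, ?_⟩, ?_⟩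
  · intro k
    rw [hstep, Fin.val_add_one]
    split_ifs with hk
    · have hj : i + (k : ℕ) + 1 = j := by
        rw [hk, Fin.val_last]
        omega
      rw [hj, add_zero, hclose]
    · rfl
  · intro a b h
    have := hinj _ (by omega) _ (by omega) h
    exact Fin.ext (by omega)
  · intro a b h
    rcases M.edge_eq_edge.1 h with h | h
    · have := hinj _ (by omega) _ (by omega) (congrArg M.face h)
      exact Fin.ext (by omega)
    · exact absurd h (hback _ (by omega) _ (by omega) (by omega))
  · intro e he
    refine if_neg ?_
    rintro ⟨k, rfl⟩
    exact (s _).2 he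

/-- A `0`-cochain is constant on each side of its coboundary. -/
theorem eq_of_mem_side {g : M.Vertex → ZMod 2} {a b : M.Vertex}
    (h : b ∈ M.side (M.cobd g) a) : g b = g a := by
  induction (h : Relation.ReflTransGen _ a b) with
  | refl => rfl
  | tail _ hstep ih =>
    obtain ⟨d, rfl, rfl, hd⟩ := hstep
    rw [← ih, M.cobd_edge_eq_zero.1 hd]

theorem IsConnectedRegion.induction {M : SphereMap D} {S : Set M.Vertex}
    (hS : M.IsConnectedRegion S) {P : M.Vertex → Prop} {a : M.Vertex} (ha : a ∈ S) (h0 : P a)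
    (hstep : ∀ d, M.src d ∈ S → M.tgt d ∈ S → P (M.src d) → P (M.tgt d)) {v : M.Vertex}
    (hv : v ∈ S) : P v := by
  have h := hS.2 a ha v hv
  clear hv
  induction h with
  | refl => exact h0
  | tail _ h ih =>
    obtain ⟨h1, h2, d, rfl, rfl⟩ := h
    exact hstep d h1 h2 ih

theorem mem_side_comm {w : M.Edge → ZMod 2} {a b : M.Vertex} (h : b ∈ M.side w a) :
    a ∈ M.side w b := by
  induction (h : Relation.ReflTransGen _ a b) with
  | refl => exact Relation.ReflTransGen.refl
  | tail _ hstep ih =>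
    obtain ⟨d, rfl, rfl, hd⟩ := hstep
    exact Relation.ReflTransGen.head ⟨M.rev d, rfl, M.tgt_rev d, by rwa [M.edge_rev]⟩ ih

/-- The coboundary of the indicator of `K` is nonzero, so it contains a simple loop with cochain
`cobd g`. This `g` is constant on `K` and on its complement, so its two values must differ and the
loop separates. -/
theorem exists_separating_loop {R : Fin 2 → Set M.Vertex} (hR : M.IsHolePair R) :
    ∃ w : M.SimpleDualLoop, M.Separates w.cochain (R 0) (R 1) := by
  obtain ⟨a, ha⟩ := (hR.conn 0).1
  obtain ⟨b, hb⟩ := (hR.conn 1).1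
  have hdisj : ∀ v ∈ R 1, v ∉ R 0 := fun v h1 h0 => Set.disjoint_left.1 hR.disj h0 h1
  -- the component of the complement of `R 0` that contains `R 1`
  let K : Set M.Vertex := {v | Relation.ReflTransGen
    (fun x y => y ∉ R 0 ∧ ∃ d, M.src d = x ∧ M.tgt d = y) b v}
  have hbK : b ∈ K := Relation.ReflTransGen.refl
  have hK0 : ∀ v ∈ K, v ∉ R 0 := by
    intro v hv
    induction (hv : Relation.ReflTransGen _ b v) with
    | refl => exact hdisj b hb
    | tail _ h _ => exact h.1
  have hstepK : ∀ d, M.src d ∈ K → M.tgt d ∉ R 0 → M.tgt d ∈ K :=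
    fun d h1 h2 => Relation.ReflTransGen.tail h1 ⟨h2, d, rfl, rfl⟩
  let k : M.Vertex → ZMod 2 := fun v => if v ∈ K then 1 else 0
  have hk0 : M.cobd k ≠ 0 := by
    intro h
    have := M.cobd_eq_zero h b a
    simp [k, hbK, show a ∉ K from fun h => hK0 a h ha] at this
  obtain ⟨w, hw⟩ := (M.isClosedCochain_cobd k).exists_simpleDualLoop hk0
  obtain ⟨g, hg⟩ := w.isClosedCochain.exists_cobd
  rw [← hg] at hw
  have hgeq : ∀ d, (M.src d ∈ K ↔ M.tgt d ∈ K) → g (M.src d) = g (M.tgt d) := by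
    intro d hd
    refine M.cobd_edge_eq_zero.1 (hw _ (M.cobd_edge_eq_zero.2 ?_))
    simp [k, hd]
  have hgK : ∀ v ∈ K, g v = g b := by
    intro v hv
    induction (hv : Relation.ReflTransGen _ b v) with
    | refl => rfl
    | tail hx h ih =>
      obtain ⟨h1, d, rfl, rfl⟩ := h
      rw [← ih]
      exact (hgeq d (iff_of_true hx (hstepK d hx h1))).symm
  have hg0 : ∀ v ∈ R 0, g v = g a := by
    intro v hv
    refine (hR.conn 0).induction (P := fun v => g v = g a) ha rfl (fun d h1 h2 h => ?_) hv
    rw [← h]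
    exact (hgeq d (iff_of_false (fun h => hK0 _ h h1) (fun h => hK0 _ h h2))).symm
  have hgKc : ∀ v ∉ K, g v = g a := by
    have hcross : ∀ d, M.src d ∈ K → M.tgt d ∉ K → g (M.tgt d) = g a := fun d h1 h2 =>
      hg0 _ (by_contra fun h => h2 (hstepK d h1 h))
    intro v hv
    -- Every edge leaving `K` ends in `R 0`, where `g` equals `g a`. Overwriting `g` by `g a` on `K`
    -- thus gives a function constant along all edges.
    have := M.vertex_const (fun v => if v ∈ K then g a else g v) (fun d => ?_) v a
    · simpa [hv] using this
    · by_cases h1 : M.src d ∈ K <;> by_cases h2 : M.tgt d ∈ K <;>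
        simp only [h1, h2, if_true, if_false]
      · exact (hcross d h1 h2).symm
      · have := hcross (M.rev d) h2 (by rwa [M.tgt_rev])
        rwa [M.tgt_rev] at this
      · exact hgeq d (iff_of_false h1 h2)
  have hgab : g b ≠ g a := by
    intro h
    have hall : ∀ v, g v = g a := fun v => by
      by_cases hv : v ∈ K
      · rw [hgK v hv, h]
      · exact hgKc v hv
    have h1 : w.cochain (M.edge (w.dart 0)) = 1 := if_pos ⟨0, rfl⟩
    rw [← hg, M.cobd_edge_eq_zero.2 (by rw [hall, hall (M.tgt _)])] at h1
    exact zero_ne_one h1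
  have hg1 : ∀ v ∈ R 1, g v = g b := by
    intro v hv
    refine hgK v ((hR.conn 1).induction (P := (· ∈ K)) hb hbK (fun d _ h2 h => ?_) hv)
    exact hstepK d h (hdisj _ h2)
  refine ⟨w, a, b, fun v hv => ?_, fun v hv => ?_, fun h => ?_⟩
  · refine (hR.conn 0).induction ha Relation.ReflTransGen.refl (fun d h1 h2 h => ?_) hv
    refine Relation.ReflTransGen.tail h ⟨d, rfl, rfl, ?_⟩
    rw [← hg, M.cobd_edge_eq_zero, hg0 _ h1, hg0 _ h2]
  · refine (hR.conn 1).induction hb Relation.ReflTransGen.refl (fun d h1 h2 h => ?_) hv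
    refine Relation.ReflTransGen.tail h ⟨d, rfl, rfl, ?_⟩
    rw [← hg, M.cobd_edge_eq_zero, hg1 _ h1, hg1 _ h2]
  · rw [← hg] at h
    exact hgab (M.eq_of_mem_side h)

theorem pairing_eq_one_of_separates {R : Fin 2 → Set M.Vertex} {w : M.SimpleDualLoop}
    (hw : M.Separates w.cochain (R 0) (R 1)) {p : M.SimplePath} (hp : M.IsBridge R p) :
    M.pairing w.cochain p.chain = 1 := by
  obtain ⟨a, b, hRa, hRb, hab⟩ := hw
  let g : M.Vertex → ZMod 2 := fun v => if v ∈ M.side w.cochain a then 1 else 0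
  have hsupp : ∀ e, w.cochain e = 0 → M.cobd g e = 0 := by
    intro e he
    obtain ⟨d, rfl⟩ := M.edge_surjective e
    rw [cobd_edge_eq_zero]
    have : M.src d ∈ M.side w.cochain a ↔ M.tgt d ∈ M.side w.cochain a :=
      ⟨fun h => Relation.ReflTransGen.tail h ⟨d, rfl, rfl, he⟩,
        fun h => Relation.ReflTransGen.tail h
          ⟨M.rev d, rfl, M.tgt_rev d, by rwa [M.edge_rev]⟩⟩
    simp [g, this]
  have h0 : M.cobd g ≠ 0 := by
    intro h
    have := M.cobd_eq_zero h a b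
    simp [g, hab, show a ∈ M.side w.cochain a from Relation.ReflTransGen.refl] at this
  -- By minimality `w` is exactly the coboundary of the indicator of its side.
  rw [← w.eq_cochain hsupp (M.isClosedCochain_cobd g) h0, pairing_cobd_chain]
  have h1 : p.vert 0 ∈ M.side w.cochain a := hRa hp.start_mem.1
  have h2 : p.vert (Fin.last p.length) ∉ M.side w.cochain a := fun h =>
    hab (Relation.ReflTransGen.trans h (M.mem_side_comm (hRb hp.end_mem.1)))
  simp [g, h1, h2]

end SphereMap

namespace SphereMap

variable {D : Type*} [Finite D] (M : SphereMap D)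

/-! ### The quotient complex -/

section Quotient

variable {R : Fin 2 → Set M.Vertex}

theorem hatVertex_of_mem (hR : M.IsHolePair R) {i : Fin 2} {v : M.Vertex} (hv : v ∈ R i) :
    M.hatVertex R v = Sum.inr i := by
  rw [hatVertex, dif_neg (fun h => h i hv)]
  fin_cases i
  · exact if_pos hv
  · exact if_neg fun h => Set.disjoint_left.1 hR.disj h hv

/-- Extension by zero of a cochain on the edges of the quotient. -/
def extendEdge (u : M.HatEdge R → ZMod 2) : M.Edge → ZMod 2 :=
  fun e => if h : ¬ ∃ i, ∀ d, M.edge d = e → M.src d ∈ R i then u ⟨e, h⟩ else 0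

theorem sum_hatEdge (u : M.HatEdge R → ZMod 2) (h : M.Edge → ZMod 2) :
    ∑ e : M.HatEdge R, u e * h e.1 = ∑ e, M.extendEdge u e * h e := by
  have h1 : ∀ e : M.HatEdge R, u e * h e.1 = M.extendEdge u e.1 * h e.1 := fun e => by
    rw [extendEdge, dif_pos e.2]
  rw [Finset.sum_congr rfl fun e _ => h1 e,
    ← Finset.sum_subtype (Finset.univ.filter fun e : M.Edge =>
      ¬ ∃ i, ∀ d, M.edge d = e → M.src d ∈ R i) (by simp) (fun e => M.extendEdge u e * h e),
    Finset.sum_filter]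
  refine Finset.sum_congr rfl fun e _ => ?_
  by_cases he : ¬ ∃ i, ∀ d, M.edge d = e → M.src d ∈ R i
  · rw [if_pos he]
  · rw [if_neg he, extendEdge, dif_neg he, zero_mul]

theorem cobd_hatVertex_eq_zero (hR : M.IsHolePair R) (g : M.HatVertex R → ZMod 2) {e : M.Edge}
    (he : ∃ i, ∀ d, M.edge d = e → M.src d ∈ R i) :
    M.cobd (fun v => g (M.hatVertex R v)) e = 0 := by
  obtain ⟨i, hi⟩ := he
  obtain ⟨d, rfl⟩ := M.edge_surjective e
  rw [cobd_edge_eq_zero, tgt, M.hatVertex_of_mem hR (hi d rfl),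
    M.hatVertex_of_mem hR (hi (M.rev d) (M.edge_rev d))]

theorem vecMul_hatD (g : M.HatVertex R → ZMod 2) (e : M.HatEdge R) :
    (g ᵥ* M.hatD R) e = M.cobd (fun v => g (M.hatVertex R v)) e.1 := by
  have h : (M.hatD R)ᵀ = (incidence M.edge (fun d => M.hatVertex R (M.src d))).submatrix
      Subtype.val id := by
    rfl
  let _ := Fintype.ofFinite D
  rw [← mulVec_transpose, h, cobd, incidence_mulVec]
  exact incidence_mulVec M.edge (fun d => M.hatVertex R (M.src d)) g e.1

theorem extendEdge_vecMul_hatD (hR : M.IsHolePair R) (g : M.HatVertex R → ZMod 2) :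
    M.extendEdge (g ᵥ* M.hatD R) = M.cobd fun v => g (M.hatVertex R v) := by
  funext e
  by_cases he : ¬ ∃ i, ∀ d, M.edge d = e → M.src d ∈ R i
  · rw [extendEdge, dif_pos he]
    exact M.vecMul_hatD g _
  · rw [extendEdge, dif_neg he]
    exact (M.cobd_hatVertex_eq_zero hR g (not_not.1 he)).symm

theorem dotProduct_hatD_mulVec_hatChain (hR : M.IsHolePair R) (g : M.HatVertex R → ZMod 2)
    (c : M.Edge → ZMod 2) : g ⬝ᵥ (M.hatD R *ᵥ M.hatChain R c) =
      M.pairing (M.cobd fun v => g (M.hatVertex R v)) c := by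
  rw [dotProduct_mulVec, pairing, ← M.extendEdge_vecMul_hatD hR]
  exact M.sum_hatEdge _ _

theorem vecMul_hatB (u : M.HatEdge R → ZMod 2) (f : M.HatFace R) :
    (u ᵥ* M.hatB R) f = (incidence M.face M.edge *ᵥ M.extendEdge u) f.1 := by
  have h : ∀ e, M.hatB R e f = incidence M.edge M.face e.1 f.1 :=
    fun e => rfl
  rw [← incidence_transpose, mulVec_transpose]
  simp only [vecMul, dotProduct, h]
  exact M.sum_hatEdge u fun e => incidence M.edge M.face e f.1

/-- Both vertices of an edge of a face lying in a hole are in that hole. -/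
theorem edge_mem_hole {i : Fin 2} {f : M.Face} (hf : ∀ d, M.face d = f → M.src d ∈ R i) {d : D}
    (hd : M.face d = f) : ∀ d', M.edge d' = M.edge d → M.src d' ∈ R i := by
  intro d' h
  rcases M.edge_eq_edge.1 h with rfl | rfl
  · exact hf _ hd
  · have := hf _ ((M.face_next d).trans hd)
    rwa [M.src_next] at this

/-- A face inside a hole has only edges inside that hole, where the extension vanishes; every other
face survives in the quotient. -/
theorem isClosedCochain_extendEdge {u : M.HatEdge R → ZMod 2} (hu : u ᵥ* M.hatB R = 0) :
    M.IsClosedCochain (M.extendEdge u) := by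
  funext f
  by_cases hf : ∃ i, ∀ d, M.face d = f → M.src d ∈ R i
  · obtain ⟨i, hi⟩ := hf
    let _ := Fintype.ofFinite D
    rw [incidence_mulVec]
    refine Finset.sum_eq_zero fun d _ => ?_
    split_ifs with hd
    · rw [extendEdge, dif_neg (not_not.2 ⟨i, M.edge_mem_hole hi hd⟩)]
    · rfl
  · exact (M.vecMul_hatB u ⟨f, hf⟩).symm.trans (congrFun hu _)

theorem vecMul_hatD_vecMul_hatB (hR : M.IsHolePair R) (g : M.HatVertex R → ZMod 2) :
    (g ᵥ* M.hatD R) ᵥ* M.hatB R = 0 := by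
  funext f
  rw [vecMul_hatB, M.extendEdge_vecMul_hatD hR]
  exact congrFun (M.isClosedCochain_cobd _) f.1

/-- A cochain of the quotient that vanishes on all face boundaries is a coboundary. -/
theorem exists_vecMul_hatD (hR : M.IsHolePair R) {u : M.HatEdge R → ZMod 2}
    (hu : u ᵥ* M.hatB R = 0) : ∃ g, g ᵥ* M.hatD R = u := by
  obtain ⟨g, hg⟩ := (M.isClosedCochain_extendEdge hu).exists_cobd
  choose r hr using fun i => (hR.conn i).1
  -- The extension vanishes on edges inside a hole, and the hole is connected through such edges.
  have hconst : ∀ i, ∀ v ∈ R i, g v = g (r i) := by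
    intro i v hv
    refine (hR.conn i).induction (P := fun v => g v = g (r i)) (hr i) rfl (fun d h1 h2 h => ?_) hv
    rw [← h]
    refine (M.cobd_edge_eq_zero.1 ?_).symm
    refine (congrFun hg _).trans (dif_neg (not_not.2 ⟨i, fun d' hd' => ?_⟩))
    rcases M.edge_eq_edge.1 hd' with rfl | rfl
    · exact h1
    · exact h2
  refine ⟨Sum.elim (fun v => g v.1) (fun i => g (r i)), funext fun e => ?_⟩
  have hlift : (fun v => (Sum.elim (fun v => g v.1) (fun i => g (r i)) : M.HatVertex R → ZMod 2)
      (M.hatVertex R v)) = g := by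
    funext v
    by_cases hv : ∀ i, v ∉ R i
    · rw [hatVertex, dif_pos hv, Sum.elim_inl]
    · push Not at hv
      obtain ⟨i, hi⟩ := hv
      rw [M.hatVertex_of_mem hR hi, Sum.elim_inr, hconst i v hi]
  rw [vecMul_hatD, hlift, hg, extendEdge, dif_pos e.2]

/-- Linear duality: a functional killing all face boundaries is a closed cochain, hence a
coboundary, hence kills every cycle. -/
theorem mem_relBoundaries_of_hatD_eq_zero (hR : M.IsHolePair R) {c : M.HatEdge R → ZMod 2}
    (hc : M.hatD R *ᵥ c = 0) : c ∈ M.relBoundaries R := by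
  by_contra hmem
  obtain ⟨f, hf, hle⟩ := Submodule.exists_le_ker_of_notMem hmem
  let u : M.HatEdge R → ZMod 2 := fun e => f (Pi.single e 1)
  have hfu : ∀ x, f x = u ⬝ᵥ x := by
    intro x
    rw [f.pi_apply_eq_sum_univ x]
    refine Finset.sum_congr rfl fun e _ => ?_
    rw [smul_eq_mul, mul_comm]
    congr 2
    funext e'
    simp [Pi.single_apply, eq_comm]
  have hu : u ᵥ* M.hatB R = 0 := by
    funext x
    have h := hle (LinearMap.mem_range_self (M.hatB R).mulVecLin (Pi.single x 1))
    rw [LinearMap.mem_ker, hfu, mulVecLin_apply, dotProduct_mulVec] at h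
    simpa using h
  obtain ⟨g, hg⟩ := M.exists_vecMul_hatD hR hu
  apply hf
  rw [hfu, ← hg, ← dotProduct_mulVec, hc, dotProduct_zero]

theorem hatD_mulVec_of_mem_relBoundaries (hR : M.IsHolePair R) {c : M.HatEdge R → ZMod 2}
    (hc : c ∈ M.relBoundaries R) : M.hatD R *ᵥ c = 0 := by
  obtain ⟨x, rfl⟩ := hc
  funext y
  have h : Pi.single y 1 ⬝ᵥ (M.hatD R *ᵥ (M.hatB R *ᵥ x)) = 0 := by
    rw [dotProduct_mulVec, dotProduct_mulVec, M.vecMul_hatD_vecMul_hatB hR, zero_dotProduct]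
  simpa using h

theorem hatD_mulVec_bridge (hR : M.IsHolePair R) {p : M.SimplePath} (hp : M.IsBridge R p) :
    M.hatD R *ᵥ M.hatChain R p.chain = Pi.single (Sum.inr 0) 1 + Pi.single (Sum.inr 1) 1 := by
  funext x
  have h := M.dotProduct_hatD_mulVec_hatChain hR (Pi.single x 1) p.chain
  rw [pairing_cobd_chain, M.hatVertex_of_mem hR hp.start_mem.1,
    M.hatVertex_of_mem hR hp.end_mem.1, single_one_dotProduct] at h
  rw [h]
  simp [Pi.single_apply, eq_comm]

theorem mem_markedChains {y : M.HatVertex R → ZMod 2} :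
    y ∈ M.markedChains R ↔ ∀ v, y (Sum.inl v) = 0 := by
  constructor
  · intro hy v
    induction hy using Submodule.span_induction with
    | mem x hx =>
      obtain ⟨i, rfl⟩ := hx
      simp
    | zero => rfl
    | add x y _ _ hx hy => rw [Pi.add_apply, hx, hy, add_zero]
    | smul a x _ hx => rw [Pi.smul_apply, hx, smul_zero]
  · intro hy
    have : y = ∑ i : Fin 2, y (Sum.inr i) • Pi.single (Sum.inr i) 1 := by
      funext x
      rcases x with v | i
      · simp [hy]
      · fin_cases i <;> simp
    rw [this]
    exact Submodule.sum_mem _ fun i _ =>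
      Submodule.smul_mem _ _ (Submodule.subset_span ⟨i, rfl⟩)

theorem mem_relCycles {c : M.HatEdge R → ZMod 2} :
    c ∈ M.relCycles R ↔ ∀ v, (M.hatD R *ᵥ c) (Sum.inl v) = 0 :=
  M.mem_markedChains

theorem bridge_mem_relCycles (hR : M.IsHolePair R) {p : M.SimplePath} (hp : M.IsBridge R p) :
    M.hatChain R p.chain ∈ M.relCycles R := by
  rw [mem_relCycles, M.hatD_mulVec_bridge hR hp]
  simp

/-! ### Relative homology and plaquette sums -/

theorem exists_chain_joining (a b : M.Vertex) :
    ∃ c : M.Edge → ZMod 2, ∀ g, M.pairing (M.cobd g) c = g a + g b := by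
  let P : M.Vertex → Prop := fun v =>
    ∃ c : M.Edge → ZMod 2, ∀ g, M.pairing (M.cobd g) c = g a + g v
  have hstep : ∀ d, P (M.src d) → P (M.tgt d) := by
    rintro d ⟨c, hc⟩
    refine ⟨c + Pi.single (M.edge d) 1, fun g => ?_⟩
    have h1 : M.pairing (M.cobd g) (c + Pi.single (M.edge d) 1) =
        M.pairing (M.cobd g) c + M.cobd g (M.edge d) := by
      simp [pairing, mul_add, Finset.sum_add_distrib, Pi.single_apply]
    rw [h1, hc, cobd_edge, add_assoc, ← add_assoc (g (M.src d)), CharTwo.add_self_eq_zero,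
      zero_add]
  have hPa : P a := ⟨0, fun g => by simp [pairing, CharTwo.add_self_eq_zero]⟩
  have := M.vertex_const P (fun d => propext ⟨hstep d, fun h => by
    have := hstep (M.rev d) h
    rwa [M.tgt_rev] at this⟩) a b
  exact this.mp hPa

/-- The coefficient of the boundary of a relative cycle at the second hole. -/
def boundaryAtHole (R : Fin 2 → Set M.Vertex) : M.relCycles R →ₗ[ZMod 2] ZMod 2 :=
  LinearMap.proj (Sum.inr 1) ∘ₗ (M.hatD R).mulVecLin ∘ₗ (M.relCycles R).subtype

/-- No bridge is assumed here: the image of any chain joining the holes has boundary `r̂₀ + r̂₁`,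
even if it runs through them. -/
theorem boundaryAtHole_surjective (hR : M.IsHolePair R) :
    Function.Surjective (M.boundaryAtHole R) := by
  obtain ⟨a, ha⟩ := (hR.conn 0).1
  obtain ⟨b, hb⟩ := (hR.conn 1).1
  obtain ⟨c, hc⟩ := M.exists_chain_joining a b
  have hD : ∀ x, (M.hatD R *ᵥ M.hatChain R c) x =
      (Pi.single x 1 : M.HatVertex R → ZMod 2) (Sum.inr 0) +
      (Pi.single x 1 : M.HatVertex R → ZMod 2) (Sum.inr 1) := by
    intro x
    have h := M.dotProduct_hatD_mulVec_hatChain hR (Pi.single x 1) c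
    rwa [hc, M.hatVertex_of_mem hR ha, M.hatVertex_of_mem hR hb, single_one_dotProduct] at h
  have hmem : M.hatChain R c ∈ M.relCycles R := by
    rw [mem_relCycles]
    intro v
    simp [hD]
  refine fun z => ⟨z • ⟨_, hmem⟩, ?_⟩
  have : M.boundaryAtHole R ⟨_, hmem⟩ = 1 := (hD _).trans (by simp)
  rw [map_smul, this, smul_eq_mul, mul_one]

theorem ker_boundaryAtHole (hR : M.IsHolePair R) : LinearMap.ker (M.boundaryAtHole R) =
    (M.relBoundaries R).submoduleOf (M.relCycles R) := by
  ext ⟨c, hc⟩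
  rw [LinearMap.mem_ker, Submodule.submoduleOf, Submodule.mem_comap]
  constructor
  · intro h
    refine M.mem_relBoundaries_of_hatD_eq_zero hR ?_
    rw [mem_relCycles] at hc
    have h1 : (M.hatD R *ᵥ c) (Sum.inr 1) = 0 := h
    -- A boundary has even total weight, so a relative cycle with coefficient zero at one hole has
    -- it at the other too.
    have hsum : (fun _ => 1 : M.HatVertex R → ZMod 2) ⬝ᵥ (M.hatD R *ᵥ c) = 0 := by
      have h2 : (fun _ => 1 : M.HatVertex R → ZMod 2) ᵥ* M.hatD R = 0 := by
        funext e
        obtain ⟨d, hd⟩ := M.edge_surjective e.1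
        rw [vecMul_hatD, ← hd, cobd_edge, CharTwo.add_self_eq_zero]
        rfl
      rw [dotProduct_mulVec, h2, zero_dotProduct]
    have h0 : (M.hatD R *ᵥ c) (Sum.inr 0) = 0 := by
      simpa [dotProduct, Fintype.sum_sum_type, hc, h1] using hsum
    funext x
    rcases x with v | i
    · exact hc v
    · fin_cases i
      · exact h0
      · exact h1
  · intro h
    exact congrFun (M.hatD_mulVec_of_mem_relBoundaries hR h) _

theorem nonempty_relH1_equiv (hR : M.IsHolePair R) :
    Nonempty (M.RelH1 R ≃ₗ[ZMod 2] ZMod 2) :=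
  ⟨(Submodule.quotEquivOfEq _ _ (M.ker_boundaryAtHole hR).symm).trans
    (LinearMap.quotKerEquivOfSurjective _ (M.boundaryAtHole_surjective hR))⟩

theorem bridge_add_bridge_mem_relBoundaries (hR : M.IsHolePair R) {p q : M.SimplePath}
    (hp : M.IsBridge R p) (hq : M.IsBridge R q) :
    M.hatChain R p.chain + M.hatChain R q.chain ∈ M.relBoundaries R := by
  refine M.mem_relBoundaries_of_hatD_eq_zero hR ?_
  rw [mulVec_add, M.hatD_mulVec_bridge hR hp, M.hatD_mulVec_bridge hR hq]
  exact CharTwo.add_self_eq_zero _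

theorem bridge_notMem_relBoundaries (hR : M.IsHolePair R) {q : M.SimplePath}
    (hq : M.IsBridge R q) : M.hatChain R q.chain ∉ M.relBoundaries R := by
  intro h
  have h1 := M.hatD_mulVec_of_mem_relBoundaries hR h
  rw [M.hatD_mulVec_bridge hR hq] at h1
  have h2 := congrFun h1 (Sum.inr 1)
  simp at h2

/-- The boundaries of all faces of the quotient add up to zero. -/
theorem hatB_mulVec_one : M.hatB R *ᵥ (fun _ => 1) = 0 := by
  funext e
  obtain ⟨d, hd⟩ := M.edge_surjective e.1
  -- Both sides of a surviving edge lie on surviving faces, so none of its two incidences is lost.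
  have hface : ∀ d', M.edge d' = e.1 →
      ¬ ∃ i, ∀ d, M.face d = M.face d' → M.src d ∈ R i := by
    rintro d' hd' ⟨i, hi⟩
    exact e.2 ⟨i, fun d hd => M.edge_mem_hole hi rfl d (hd.trans hd'.symm)⟩
  have h1 : ∀ d', M.edge d' = e.1 →
      ∑ f : M.HatFace R, (if M.face d' = f.1 then (1 : ZMod 2) else 0) = 1 := by
    intro d' hd'
    rw [Finset.sum_eq_single ⟨M.face d', hface d' hd'⟩]
    · simp
    · intro f _ hf
      exact if_neg fun h => hf (Subtype.ext h.symm)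
    · simp
  have h2 : ∀ d', (∑ f : M.HatFace R, if M.edge d' = M.edge d then
      (if M.face d' = f.1 then (1 : ZMod 2) else 0) else 0) =
      if M.edge d' = M.edge d then 1 else 0 := by
    intro d'
    split_ifs with hd'
    · exact h1 d' (hd'.trans hd)
    · simp
  let _ := Fintype.ofFinite D
  have h : ∀ f : M.HatFace R, M.hatB R e f * 1 =
      ∑ d', if M.edge d' = M.edge d then (if M.face d' = f.1 then 1 else 0) else 0 := by
    intro f
    rw [mul_one, hd]
    refine (incidence_apply M.edge M.face _ _).trans (Finset.sum_congr rfl fun d' _ => ?_)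
    rw [ite_and]
  simp only [mulVec, dotProduct]
  rw [Finset.sum_congr rfl fun f _ => h f, Finset.sum_comm]
  rw [Finset.sum_congr rfl fun d' _ => h2 d']
  exact (M.sum_edge_eq (fun _ => 1) d).trans (CharTwo.add_self_eq_zero _)

theorem exists_plaquettes {c : M.HatEdge R → ZMod 2} (hc : c ∈ M.relBoundaries R) :
    ∃ S : Finset (M.Plaquette R), c = ∑ f ∈ S, fun e => M.hatB R e f.1 := by
  obtain ⟨x, rfl⟩ := hc
  obtain ⟨y, hy, hy0⟩ : ∃ y, M.hatB R *ᵥ y = M.hatB R *ᵥ x ∧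
      ∀ f : M.HatFace R, f.1 = M.outer → y f = 0 := by
    by_cases h : ∃ f : M.HatFace R, f.1 = M.outer
    · obtain ⟨f, hf⟩ := h
      -- Adding all faces at once leaves the boundary unchanged and cancels the coefficient of the
      -- outer face.
      refine ⟨x + x f • fun _ => 1, ?_, fun f' hf' => ?_⟩
      · rw [mulVec_add, mulVec_smul, hatB_mulVec_one, smul_zero, add_zero]
      · rw [Subtype.ext (hf'.trans hf.symm)]
        simp [CharTwo.add_self_eq_zero]
    · exact ⟨x, rfl, fun f hf => absurd ⟨f, hf⟩ h⟩
  refine ⟨Finset.univ.filter fun f => y f.1 ≠ 0, ?_⟩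
  rw [mulVecLin_apply, ← hy]
  funext e
  rw [Finset.sum_apply, Finset.sum_filter]
  have h1 : ∀ f : M.Plaquette R, (if y f.1 ≠ 0 then M.hatB R e f.1 else 0) =
      M.hatB R e f.1 * y f.1 := by
    intro f
    split_ifs with h
    · have h1 : y f.1 = 1 := Fin.eq_one_of_ne_zero _ h
      rw [h1, mul_one]
    · rw [not_not.1 h, mul_zero]
  rw [Finset.sum_congr rfl fun f _ => h1 f,
    ← Finset.sum_subtype (Finset.univ.filter fun f : M.HatFace R => f.1 ≠ M.outer) (by simp)
      (fun f => M.hatB R e f * y f), Finset.sum_filter]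
  refine Finset.sum_congr rfl fun f _ => ?_
  split_ifs with h
  · rfl
  · rw [hy0 f (not_not.1 h), mul_zero]

end Quotient

end SphereMap

/-! ### Pauli operators on states -/

theorem neg_one_pow_val_add (a b : ZMod 2) :
    (-1 : ℂ) ^ (a + b).val = (-1) ^ a.val * (-1) ^ b.val := by
  have h : (a + b).val % 2 = (a.val + b.val) % 2 := by
    revert a b; decide
  rw [← pow_add, neg_one_pow_eq_pow_mod_two, h, ← neg_one_pow_eq_pow_mod_two]

theorem pauliZ_apply {Q : Type*} [Fintype Q] (c : Q → ZMod 2) (ψ : QubitSpace Q)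
    (x : Q → ZMod 2) : pauliZ c ψ x = (-1) ^ (c ⬝ᵥ x).val * ψ x := by
  have h : ∀ s : Finset Q, (∏ e ∈ s, (-1 : ℂ) ^ (c e * x e).val) =
      (-1) ^ (∑ e ∈ s, c e * x e).val := by
    intro s
    induction s using Finset.induction_on with
    | empty => simp
    | insert e s he ih =>
      rw [Finset.prod_insert he, Finset.sum_insert he, neg_one_pow_val_add, ih]
  exact congrArg (· * ψ x) (h Finset.univ)

theorem pauliX_apply {Q : Type*} [Fintype Q] (w : Q → ZMod 2) (ψ : QubitSpace Q)
    (x : Q → ZMod 2) : pauliX w ψ x = ψ (x + w) := rfl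

/-- The unnormalized uniform superposition of the bit strings in a coset of `W`. -/
def cosetState {Q : Type*} [Fintype Q] (W : Submodule (ZMod 2) (Q → ZMod 2)) (t : Q → ZMod 2) :
    QubitSpace Q :=
  WithLp.toLp 2 fun x => if x + t ∈ W then 1 else 0

section CosetState

variable {Q : Type*} [Fintype Q] {W : Submodule (ZMod 2) (Q → ZMod 2)}

theorem cosetState_apply (t x : Q → ZMod 2) :
    cosetState W t x = if x + t ∈ W then 1 else 0 := rfl

theorem cosetState_ne_zero (t : Q → ZMod 2) : cosetState W t ≠ 0 := by
  intro h
  have h1 : cosetState W t t = 0 := by rw [h]; rfl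
  rw [cosetState_apply, if_pos] at h1
  · exact one_ne_zero h1
  · rw [ZModModule.add_self]
    exact W.zero_mem

theorem pauliX_cosetState {s : Q → ZMod 2} (hs : s ∈ W) (t : Q → ZMod 2) :
    pauliX s (cosetState W t) = cosetState W t := by
  ext x
  rw [pauliX_apply, cosetState_apply, cosetState_apply, add_right_comm]
  exact if_congr (W.add_mem_iff_left hs) rfl rfl

/-- Orthogonality to `W` makes the sign of `Z(c)` constant on the coset of `t`. -/
theorem pauliZ_cosetState {c : Q → ZMod 2} (hc : ∀ s ∈ W, c ⬝ᵥ s = 0) (t : Q → ZMod 2) :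
    pauliZ c (cosetState W t) = (-1 : ℂ) ^ (c ⬝ᵥ t).val • cosetState W t := by
  ext x
  rw [pauliZ_apply, PiLp.smul_apply, cosetState_apply, smul_eq_mul]
  split_ifs with h
  · have h1 := hc _ h
    rw [dotProduct_add, CharTwo.add_eq_zero] at h1
    rw [h1]
  · rw [mul_zero, mul_zero]

end CosetState

theorem pauliZ_sum {Q ι : Type*} [Fintype Q] (S : Finset ι) (b : ι → Q → ZMod 2) :
    pauliZ (∑ f ∈ S, b f) = (S.toList.map fun f => pauliZ (b f)).prod := by
  have h : ∀ l : List ι, pauliZ (l.map b).sum = (l.map fun f => pauliZ (b f)).prod := by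
    intro l
    induction l with
    | nil =>
      ext ψ x
      simp [pauliZ_apply]
    | cons f l ih => rw [List.map_cons, List.sum_cons, pauliZ_add, ih, List.map_cons,
        List.prod_cons]
  rw [← h, Finset.sum_map_toList]

namespace SphereMap

variable {D : Type*} [Finite D] (M : SphereMap D) {R : Fin 2 → Set M.Vertex}

/-! ### The punctured surface code -/

theorem mem_codeSpace {ψ : QubitSpace (M.HatEdge R)} : ψ ∈ M.codeSpace R ↔
    (∀ v, M.starCheck R v ψ = ψ) ∧ ∀ f : M.Plaquette R, M.plaquetteCheck R f.1 ψ = ψ := by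
  simp only [codeSpace, Submodule.mem_inf, Submodule.mem_iInf, Module.End.mem_eigenspace_iff,
    one_smul]

theorem codeProj_apply_mem (ψ : QubitSpace (M.HatEdge R)) : M.codeProj R ψ ∈ M.codeSpace R :=
  Submodule.starProjection_apply_mem _ _

theorem codeProj_of_mem {ψ : QubitSpace (M.HatEdge R)} (h : ψ ∈ M.codeSpace R) :
    M.codeProj R ψ = ψ :=
  Submodule.starProjection_eq_self_iff.2 h

/-- A relative cycle meets every active star in an even number of edges, so `Z(c)` commutes with the
star checks. -/
theorem pathZ_mem_codeSpace {q : M.SimplePath} (hq : M.hatChain R q.chain ∈ M.relCycles R)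
    {ψ : QubitSpace (M.HatEdge R)} (hψ : ψ ∈ M.codeSpace R) :
    M.pathZ R q ψ ∈ M.codeSpace R := by
  rw [mem_codeSpace] at hψ ⊢
  refine ⟨fun v => ?_, fun f => ?_⟩
  · have h : M.hatChain R q.chain ⬝ᵥ (fun e => M.hatD R (Sum.inl v) e) = 0 :=
      (dotProduct_comm _ _).trans (M.mem_relCycles.1 hq v)
    ext x
    have h1 : (M.starCheck R v ψ) x = ψ x := by rw [hψ.1 v]
    rw [starCheck, pauliX_apply] at h1 ⊢
    rw [pathZ, pauliZ_apply, pauliZ_apply, dotProduct_add, h, add_zero, h1]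
  · conv_rhs => rw [← hψ.2 f]
    rw [plaquetteCheck, pathZ, ← Module.End.mul_apply, ← Module.End.mul_apply, ← pauliZ_add,
      ← pauliZ_add, add_comm]

theorem pathZ_eq_mul_plaquettes {p q : M.SimplePath} {S : Finset (M.Plaquette R)}
    (h : M.hatChain R p.chain + M.hatChain R q.chain = ∑ f ∈ S, fun e => M.hatB R e f.1) :
    M.pathZ R p = M.pathZ R q * (S.toList.map fun f => M.plaquetteCheck R f.1).prod := by
  simp only [plaquetteCheck]
  rw [← pauliZ_sum S fun f e => M.hatB R e f.1, ← h, pathZ, pathZ, ← pauliZ_add, add_left_comm]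
  congr 1
  rw [ZModModule.add_self, add_zero]

theorem plaquettes_prod_apply {ψ : QubitSpace (M.HatEdge R)} (hψ : ψ ∈ M.codeSpace R)
    (l : List (M.Plaquette R)) : (l.map fun f => M.plaquetteCheck R f.1).prod ψ = ψ := by
  induction l with
  | nil => rfl
  | cons f l ih =>
    rw [List.map_cons, List.prod_cons, Module.End.mul_apply, ih, (M.mem_codeSpace.1 hψ).2 f]

/-- The span of the supports of the star checks. -/
def starSpan (R : Fin 2 → Set M.Vertex) : Submodule (ZMod 2) (M.HatEdge R → ZMod 2) :=
  Submodule.span (ZMod 2) (Set.range fun v => fun e => M.hatD R (Sum.inl v) e)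

theorem dotProduct_starSpan {c : M.HatEdge R → ZMod 2} (hc : c ∈ M.relCycles R)
    {s : M.HatEdge R → ZMod 2} (hs : s ∈ M.starSpan R) : c ⬝ᵥ s = 0 := by
  induction hs using Submodule.span_induction with
  | mem x hx =>
    obtain ⟨v, rfl⟩ := hx
    exact (dotProduct_comm _ _).trans (M.mem_relCycles.1 hc v)
  | zero => exact dotProduct_zero _
  | add x y _ _ hx hy => rw [dotProduct_add, hx, hy, add_zero]
  | smul a x _ hx => rw [dotProduct_smul, hx, smul_zero]

theorem hatD_mulVec_hatB_col (hR : M.IsHolePair R) (f : M.HatFace R) :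
    M.hatD R *ᵥ (fun e => M.hatB R e f) = 0 := by
  refine M.hatD_mulVec_of_mem_relBoundaries hR ⟨Pi.single f 1, ?_⟩
  rw [mulVecLin_apply, mulVec_single_one]
  rfl

theorem cosetState_mem_codeSpace (hR : M.IsHolePair R) {t : M.HatEdge R → ZMod 2}
    (ht : ∀ f : M.HatFace R, (fun e => M.hatB R e f) ⬝ᵥ t = 0) :
    cosetState (M.starSpan R) t ∈ M.codeSpace R := by
  rw [mem_codeSpace]
  refine ⟨fun v => pauliX_cosetState (Submodule.subset_span (Set.mem_range_self v)) t,
    fun f => ?_⟩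
  have hcyc : (fun e => M.hatB R e f.1) ∈ M.relCycles R :=
    M.mem_relCycles.2 fun v => congrFun (M.hatD_mulVec_hatB_col hR f.1) _
  rw [plaquetteCheck, pauliZ_cosetState fun s hs => M.dotProduct_starSpan hcyc hs, ht f.1]
  simp

/-- A bridge acts on the code space with both eigenvalues `1` and `-1`. -/
theorem pathZ_compression_ne_smul (hR : M.IsHolePair R) {q : M.SimplePath}
    (hq : M.IsBridge R q) (z : ℂ) :
    M.codeProj R * M.pathZ R q * M.codeProj R ≠ z • M.codeProj R := by
  intro h
  have key : ∀ t : M.HatEdge R → ZMod 2, (∀ f : M.HatFace R, (fun e => M.hatB R e f) ⬝ᵥ t = 0) →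
      (-1 : ℂ) ^ (M.hatChain R q.chain ⬝ᵥ t).val = z := by
    intro t ht
    have hmem := M.cosetState_mem_codeSpace hR ht
    have h1 := LinearMap.congr_fun h (cosetState (M.starSpan R) t)
    rw [Module.End.mul_apply, Module.End.mul_apply, LinearMap.smul_apply, M.codeProj_of_mem hmem,
      M.codeProj_of_mem (M.pathZ_mem_codeSpace (M.bridge_mem_relCycles hR hq) hmem), pathZ,
      pauliZ_cosetState fun s hs => M.dotProduct_starSpan (M.bridge_mem_relCycles hR hq) hs] at h1
    exact smul_left_injective ℂ (cosetState_ne_zero t) h1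
  -- The witnesses are `t = 0` and the star at `r̂₁`. That star is orthogonal to all face boundaries
  -- because `∂∂ = 0`, and it meets the bridge oddly because the bridge ends at `r̂₁`.
  have h0 := key 0 fun f => dotProduct_zero _
  have h1 := key (fun e => M.hatD R (Sum.inr 1) e) fun f =>
    (dotProduct_comm _ _).trans (congrFun (M.hatD_mulVec_hatB_col hR f) (Sum.inr 1))
  have h2 : M.hatChain R q.chain ⬝ᵥ (fun e => M.hatD R (Sum.inr 1) e) = 1 := by
    refine (dotProduct_comm _ _).trans
      ((congrFun (M.hatD_mulVec_bridge hR hq) (Sum.inr 1)).trans ?_)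
    simp
  rw [h2, ← h0, dotProduct_zero] at h1
  norm_num [ZMod.val_one] at h1

end SphereMap

end

theorem proposition2 {D : Type*} [Finite D] (M : SphereMap D)
    (R : Fin 2 → Set M.Vertex) (hR : M.IsHolePair R)
    {ι : Type*} (c : ι → M.SimplePath) (hc : ∀ α, M.IsBridge R (c α)) :
    -- the relative homology of the collapsed patch
    Nonempty (M.RelH1 R ≃ₗ[ZMod 2] ZMod 2) ∧
    -- every signal path agrees with every reference bridge `q`
    (∀ q : M.SimplePath, M.IsBridge R q → ∀ α,
      (∃ (hα : M.hatChain R (c α).chain ∈ M.relCycles R)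
          (hq : M.hatChain R q.chain ∈ M.relCycles R),
        (Submodule.Quotient.mk ⟨_, hα⟩ : M.RelH1 R) = Submodule.Quotient.mk ⟨_, hq⟩ ∧
        (Submodule.Quotient.mk ⟨_, hq⟩ : M.RelH1 R) ≠ 0) ∧
      (∃ S : Finset (M.Plaquette R),
        M.hatChain R (c α).chain + M.hatChain R q.chain =
          ∑ f ∈ S, (fun e => M.hatB R e f.1) ∧
        M.pathZ R (c α) = M.pathZ R q * (S.toList.map fun f => M.plaquetteCheck R f.1).prod) ∧
      M.codeProj R * M.pathZ R (c α) * M.codeProj R =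
        M.codeProj R * M.pathZ R q * M.codeProj R) ∧
    -- every bridge is a nontrivial logical operator: it preserves the code space,
    -- its compression is nonzero, and it is not a multiple of the identity there
    (∀ q : M.SimplePath, M.IsBridge R q →
      (∀ ψ ∈ M.codeSpace R, M.pathZ R q ψ ∈ M.codeSpace R) ∧
      M.codeProj R * M.pathZ R q * M.codeProj R ≠ 0 ∧
      ∀ z : ℂ, M.codeProj R * M.pathZ R q * M.codeProj R ≠ z • M.codeProj R) ∧
    -- separating simple closed dual loops exist, and each is crossed oddly by every signal path
    (∃ w : M.SimpleDualLoop, M.Separates w.cochain (R 0) (R 1)) ∧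
    (∀ w : M.SimpleDualLoop, M.Separates w.cochain (R 0) (R 1) →
      ∀ α, M.pairing w.cochain (c α).chain = 1) := by
  refine ⟨M.nonempty_relH1_equiv hR, fun q hq α => ?_, fun q hq => ⟨fun ψ hψ =>
    M.pathZ_mem_codeSpace (M.bridge_mem_relCycles hR hq) hψ, fun h => ?_,
    M.pathZ_compression_ne_smul hR hq⟩, M.exists_separating_loop hR,
    fun w hw α => M.pairing_eq_one_of_separates hw (hc α)⟩
  · have hadd := M.bridge_add_bridge_mem_relBoundaries hR (hc α) hq
    obtain ⟨S, hS⟩ := M.exists_plaquettes hadd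
    have hZ := M.pathZ_eq_mul_plaquettes hS
    refine ⟨⟨M.bridge_mem_relCycles hR (hc α), M.bridge_mem_relCycles hR hq, ?_, fun h => ?_⟩,
      ⟨S, hS, hZ⟩, ?_⟩
    · rw [Submodule.Quotient.eq, Submodule.submoduleOf, Submodule.mem_comap]
      change M.hatChain R (c α).chain - M.hatChain R q.chain ∈ M.relBoundaries R
      rwa [ZModModule.sub_eq_add]
    · rw [Submodule.Quotient.mk_eq_zero] at h
      exact M.bridge_notMem_relBoundaries hR hq h
    · refine LinearMap.ext fun ψ => ?_
      rw [hZ]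
      simp only [Module.End.mul_apply]
      rw [M.plaquettes_prod_apply (M.codeProj_apply_mem ψ)]
  · exact M.pathZ_compression_ne_smul hR hq 0 (by rw [h, zero_smul])
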